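/- Definitions. A map between normed spaces is $C^{1,1}$ on an open set if it is differentiable there and its derivative is (locally) Lipschitz. A compact $C^{1,1}$ $k$-manifold embedded in $\mathbb{R}^d$ is a compact set $M\subset\mathbb{R}^d$ which, with the subspace topology, carries an atlas of charts in $\mathbb{R}^k$ (no boundary) with $C^{1,1}$ transition maps, and whose inclusion into $\mathbb{R}^d$, read in the charts, is $C^{1,1}$ with injective derivative. A $C^{1,1}$ diffeomorphism is a homeomorphism which, read in the charts, is $C^{1,1}$ together with its inverse. For a simplicial complex $T$ with finite vertex set $V$, let $|T|$ be its underlying space and let $\mathrm{St}(v,T)$ be the set of simplices of $T$ incident to the vertex $v$; for $h:|T|\to A$, $h(\mathrm{St}(v,T))$ denotes $\bigcup_{\sigma\in \mathrm{St}(v,T)}h(\sigma)$, simplices being closed. The nerve of a family $\{C_v\mid v\in V\}$ is $\{\emptyset\ne\sigma\subset V\mid \bigcap_{v\in\sigma}C_v\neq\emptyset\}$. For $X\subset\mathbb{R}^d$ and $\delta\ge 0$, $X^{\oplus\delta}$ is the union of the closed balls of radius $\delta$ centred at points of $X$; $B^\circ(x,\rho)$ is the open ball. Let $A\subset\mathbb{R}^d$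 and $\rho,\delta>0$. The complex $T$ is a $(\rho,\delta)$-nice triangulation of $A$ with respect to $(h,\mathcal{C})$ if $h:|T|\to A$ is a homeomorphism, $\mathcal{C}=\{C_v\mid v\in V\}$ is a finite family of compact sets, indexed by the vertices of $T$, with $\bigcup_v C_v=A$ and with nerve equal to $T$, and (i) $h(\sigma)\subset\bigcup_{v\in\sigma}C_v$ for all simplices $\sigma\in T$; (ii) $C_v\subset B^\circ(h(v),\rho)$ for all $v\in V$; (iii) $A\cap[\mathrm{Conv}(C_v)]^{\oplus\delta}\subset h(\mathrm{St}(v,T))$ for all $v\in V$. The set $A$ is nicely triangulable if there are $\rho_0>0$ and $\eta_0>0$ such that for every $0<\rho<\rho_0$ there is a $(\rho,\eta_0\rho)$-nice triangulation of $A$ (with respect to some $(h,\mathcal{C})$). Theorem. Let $M$ and $M'$ be compact $C^{1,1}$ $k$-manifolds (without boundary) embedded in $\mathbb{R}^d$ and $\mathbb{R}^{d'}$ respectively, and let $\Phi:M\to M'$ be a $C^{1,1}$ diffeomorphism. Then $M$ is nicely triangulable if and only if $M'$ is nicely triangulable. -/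

import Mathlib

open Set Metric Topology

noncomputable section

/-! ### Maps of class `C^{1,1}` and the groupoid of `C^{1,1}` transition maps -/

/-- A map `f` between normed spaces is of class `C^{1,1}` on an open set `s`: it is differentiable
on `s` and its derivative is locally Lipschitz on `s`. -/
def C11On {E F : Type*} [NormedAddCommGroup E] [NormedSpace ℝ E] [NormedAddCommGroup F]
    [NormedSpace ℝ F] (f : E → F) (s : Set E) : Prop :=
  DifferentiableOn ℝ f s ∧ LocallyLipschitzOn s (fderiv ℝ f)

theorem C11On.congr {E F : Type*} [NormedAddCommGroup E] [NormedSpace ℝ E] [NormedAddCommGroup F]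
    [NormedSpace ℝ F] {f g : E → F} {s : Set E} (hs : IsOpen s) (hf : C11On f s)
    (h : ∀ x ∈ s, g x = f x) : C11On g s := by
  refine ⟨hf.1.congr h, fun x hx => ?_⟩
  obtain ⟨K, t, ht, hK⟩ := hf.2 hx
  refine ⟨K, t ∩ s, Filter.inter_mem ht self_mem_nhdsWithin, fun y hy z hz => ?_⟩
  have key : ∀ w ∈ s, fderiv ℝ g w = fderiv ℝ f w := fun w hw =>
    Filter.EventuallyEq.fderiv_eq (Filter.eventuallyEq_of_mem (hs.mem_nhds hw) h)
  rw [key y hy.2, key z hz.2]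
  exact hK hy.1 hz.1

theorem C11On.of_locally {E F : Type*} [NormedAddCommGroup E] [NormedSpace ℝ E]
    [NormedAddCommGroup F] [NormedSpace ℝ F] {f : E → F} {s : Set E}
    (h : ∀ x ∈ s, ∃ v, IsOpen v ∧ x ∈ v ∧ C11On f (s ∩ v)) : C11On f s := by
  refine ⟨fun x hx => ?_, fun x hx => ?_⟩
  · obtain ⟨v, hv, hxv, hf⟩ := h x hx
    exact (differentiableWithinAt_inter (hv.mem_nhds hxv)).1 (hf.1 x ⟨hx, hxv⟩)
  · obtain ⟨v, hv, hxv, hf⟩ := h x hx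
    obtain ⟨K, t, ht, hK⟩ := hf.2 ⟨hx, hxv⟩
    refine ⟨K, t, ?_, hK⟩
    rwa [nhdsWithin_inter_of_mem' (mem_nhdsWithin_of_mem_nhds (hv.mem_nhds hxv))] at ht

theorem C11On.comp {E F G : Type*} [NormedAddCommGroup E] [NormedSpace ℝ E]
    [NormedAddCommGroup F] [NormedSpace ℝ F] [NormedAddCommGroup G] [NormedSpace ℝ G]
    {f : E → F} {g : F → G} {s : Set E} {t : Set F} (hs : IsOpen s) (ht : IsOpen t)
    (hf : C11On f s) (hg : C11On g t) : C11On (g ∘ f) (s ∩ f ⁻¹' t) := by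
  have hfat : ∀ x ∈ s, DifferentiableAt ℝ f x := fun x hx =>
    (hf.1 x hx).differentiableAt (hs.mem_nhds hx)
  have hgat : ∀ y ∈ t, DifferentiableAt ℝ g y := fun y hy =>
    (hg.1 y hy).differentiableAt (ht.mem_nhds hy)
  refine ⟨hg.1.comp (hf.1.mono inter_subset_left) fun x hx => hx.2, fun x hx => ?_⟩
  -- `f` is Lipschitz near `x`
  obtain ⟨K₁, u₁, hu₁, hK₁⟩ := hf.2 hx.1
  obtain ⟨K₂, u₂, hu₂, hK₂⟩ := hg.2 hx.2
  rw [hs.nhdsWithin_eq hx.1] at hu₁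
  rw [ht.nhdsWithin_eq hx.2] at hu₂
  have hcont : ContinuousAt (fderiv ℝ f) x := hK₁.continuousOn.continuousAt hu₁
  have hstrict : HasStrictFDerivAt f (fderiv ℝ f x) x :=
    hasStrictFDerivAt_of_hasFDerivAt_of_continuousAt
      (Filter.eventually_of_mem (hs.mem_nhds hx.1) fun y hy => (hfat y hy).hasFDerivAt) hcont
  obtain ⟨K₀, u₀, hu₀, hK₀⟩ := hstrict.exists_lipschitzOnWith
  have hcomp : ContDiff ℝ 1 (fun p : (F →L[ℝ] G) × (E →L[ℝ] F) => p.1.comp p.2) :=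
    isBoundedBilinearMap_comp.contDiff
  obtain ⟨K₃, u₃, hu₃, hK₃⟩ := hcomp.locallyLipschitz (fderiv ℝ g (f x), fderiv ℝ f x)
  have hgcont : ContinuousAt (fderiv ℝ g) (f x) := hK₂.continuousOn.continuousAt hu₂
  have hpair : ContinuousAt (fun y => (fderiv ℝ g (f y), fderiv ℝ f y)) x :=
    (ContinuousAt.comp (f := f) hgcont (hfat x hx.1).continuousAt).prodMk hcont
  refine ⟨K₃ * max (K₂ * K₀) K₁,
    (u₀ ∩ u₁ ∩ f ⁻¹' u₂ ∩ (fun y => (fderiv ℝ g (f y), fderiv ℝ f y)) ⁻¹' u₃) ∩ (s ∩ f ⁻¹' t),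
    Filter.inter_mem (mem_nhdsWithin_of_mem_nhds (Filter.inter_mem (Filter.inter_mem
      (Filter.inter_mem hu₀ hu₁) ((hfat x hx.1).continuousAt hu₂)) (hpair hu₃)))
      self_mem_nhdsWithin, ?_⟩
  have hlip : LipschitzOnWith (K₃ * max (K₂ * K₀) K₁)
      ((fun p : (F →L[ℝ] G) × (E →L[ℝ] F) => p.1.comp p.2) ∘
        fun y => (fderiv ℝ g (f y), fderiv ℝ f y))
      ((u₀ ∩ u₁ ∩ f ⁻¹' u₂ ∩ (fun y => (fderiv ℝ g (f y), fderiv ℝ f y)) ⁻¹' u₃) ∩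
        (s ∩ f ⁻¹' t)) := by
    refine hK₃.comp (LipschitzOnWith.prodMk (f := fun y => fderiv ℝ g (f y)) ?_ ?_) ?_
    · exact hK₂.comp (hK₀.mono fun y hy => hy.1.1.1.1) fun y hy => hy.1.1.2
    · exact hK₁.mono fun y hy => hy.1.1.1.2
    · exact fun y hy => hy.1.2
  have key : ∀ y ∈ s ∩ f ⁻¹' t,
      fderiv ℝ (g ∘ f) y = (fderiv ℝ g (f y)).comp (fderiv ℝ f y) := fun y hy =>
    fderiv_comp y (hgat _ hy.2) (hfat _ hy.1)
  intro y hy z hz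
  rw [key y hy.2, key z hz.2]
  exact hlip hy hz

/-- The groupoid of local homeomorphisms of `ℝ^k` that are of class `C^{1,1}` together with
their inverses. -/
def c11Groupoid (k : ℕ) : StructureGroupoid (EuclideanSpace ℝ (Fin k)) :=
  Pregroupoid.groupoid
    { property := fun f s => C11On f s
      comp := fun hf hg hu hv _ => C11On.comp hu hv hf hg
      id_mem := by
        refine ⟨differentiableOn_id, ?_⟩
        have h : fderiv ℝ (id : EuclideanSpace ℝ (Fin k) → EuclideanSpace ℝ (Fin k)) =
            fun _ => ContinuousLinearMap.id ℝ _ := funext fun x => fderiv_id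
        rw [h]
        exact (LocallyLipschitz.const _).locallyLipschitzOn
      locality := fun _ h => C11On.of_locally h
      congr := fun hu h hf => C11On.congr hu hf h }

/-- Membership in the `C^{1,1}` groupoid, spelled out. -/
theorem mem_c11Groupoid {k : ℕ}
    {e : OpenPartialHomeomorph (EuclideanSpace ℝ (Fin k)) (EuclideanSpace ℝ (Fin k))} :
    e ∈ c11Groupoid k ↔ C11On e e.source ∧ C11On e.symm e.target :=
  mem_groupoid_of_pregroupoid

/-- Let `M ⊆ ℝ^d` (with the subspace topology) carry an atlas of charts in `ℝ^k`. The inclusion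
`M → ℝ^d` is a `C^{1,1}` embedding if, read in the charts, it is of class `C^{1,1}` with injective
derivative. (It is a topological embedding because `M` has the subspace topology.) -/
def InclusionIsC11Embedding (k : ℕ) {d : ℕ} (M : Set (EuclideanSpace ℝ (Fin d)))
    [ChartedSpace (EuclideanSpace ℝ (Fin k)) M] : Prop :=
  ∀ c ∈ atlas (EuclideanSpace ℝ (Fin k)) M,
    C11On (fun u => (c.symm u : EuclideanSpace ℝ (Fin d))) c.target ∧
    ∀ u ∈ c.target,
      Function.Injective (fderiv ℝ (fun u => (c.symm u : EuclideanSpace ℝ (Fin d))) u)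

/-! ### Nerves, underlying spaces and nice triangulations -/

/-- The nerve of a family of sets: the nonempty finite sets of indices whose sets have
a common point. -/
def nerve {V X : Type*} (C : V → Set X) : PreAbstractSimplicialComplex V where
  faces := {σ | σ.Nonempty ∧ (⋂ v ∈ σ, C v).Nonempty}
  isRelLowerSet_faces := by
    rintro σ ⟨hσ, x, hx⟩
    refine ⟨hσ, fun τ hτ hne => ⟨hne, x, ?_⟩⟩
    simp only [mem_iInter] at hx ⊢
    exact fun v hv => hx v (hτ hv)

/-- The closed geometric simplex spanned by the set of vertices `σ`, in barycentric
coordinates. -/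
def closedSimplex {V : Type*} [Fintype V] (σ : Finset V) : Set (V → ℝ) :=
  {x | x ∈ stdSimplex ℝ V ∧ ∀ v ∉ σ, x v = 0}

/-- The underlying space `|T|` of a finite abstract simplicial complex. -/
def underlyingSpace {V : Type*} [Fintype V] (T : AbstractSimplicialComplex V) : Set (V → ℝ) :=
  ⋃ σ ∈ T.faces, closedSimplex σ

/-- The union of the simplices of `T` incident to the vertex `v`. -/
def starSpace {V : Type*} [Fintype V] (T : AbstractSimplicialComplex V) (v : V) : Set (V → ℝ) :=
  ⋃ σ ∈ {σ | σ ∈ T.faces ∧ v ∈ σ}, closedSimplex σ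

open scoped Classical in
/-- The vertex `v` as a point of `|T|`. -/
def vertexPoint {V : Type*} [Fintype V] (T : AbstractSimplicialComplex V) (v : V) :
    underlyingSpace T :=
  ⟨Pi.single v 1, by
    refine mem_biUnion (T.singleton_mem v) ⟨single_mem_stdSimplex ℝ v, fun w hw => ?_⟩
    exact Pi.single_eq_of_ne (by simpa using hw) 1⟩

/-- The `r`-offset of `X`: the union of the closed balls of radius `r` centred in `X`. -/
def offset {d : ℕ} (X : Set (EuclideanSpace ℝ (Fin d))) (r : ℝ) :
    Set (EuclideanSpace ℝ (Fin d)) :=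
  ⋃ x ∈ X, closedBall x r

/-- The simplicial complex `T` with finite vertex set `V` is a `(ρ, δ)`-nice triangulation of
`A ⊆ ℝ^d` with respect to the homeomorphism `h : |T| → A` and the family `C` of sets. -/
structure IsNiceTriangulation {V : Type*} [Fintype V] {d : ℕ} (A : Set (EuclideanSpace ℝ (Fin d)))
    (ρ δ : ℝ) (T : AbstractSimplicialComplex V) (h : underlyingSpace T ≃ₜ A)
    (C : V → Set (EuclideanSpace ℝ (Fin d))) : Prop where
  isCompact : ∀ v, IsCompact (C v)
  covering : ⋃ v, C v = A
  nerve_eq : nerve C = T.toPreAbstractSimplicialComplex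
  simplex_subset : ∀ σ ∈ T.faces, ∀ x : underlyingSpace T, x.1 ∈ closedSimplex σ →
    (h x : EuclideanSpace ℝ (Fin d)) ∈ ⋃ v ∈ σ, C v
  subset_ball : ∀ v, C v ⊆ ball (h (vertexPoint T v) : EuclideanSpace ℝ (Fin d)) ρ
  offset_subset : ∀ v, A ∩ offset (convexHull ℝ (C v)) δ ⊆
    {p | ∃ x : underlyingSpace T, x.1 ∈ starSpace T v ∧ (h x : EuclideanSpace ℝ (Fin d)) = p}

/-- `A ⊆ ℝ^d` is nicely triangulable: there are `ρ₀ > 0` and `η₀ > 0` such that for all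
`0 < ρ < ρ₀` there is a `(ρ, η₀ ρ)`-nice triangulation of `A`. -/
def NicelyTriangulable {d : ℕ} (A : Set (EuclideanSpace ℝ (Fin d))) : Prop :=
  ∃ ρ₀ > (0 : ℝ), ∃ η₀ > (0 : ℝ), ∀ ρ : ℝ, 0 < ρ → ρ < ρ₀ →
    ∃ (V : Type) (_ : Fintype V) (T : AbstractSimplicialComplex V) (h : underlyingSpace T ≃ₜ A)
      (C : V → Set (EuclideanSpace ℝ (Fin d))), IsNiceTriangulation A ρ (η₀ * ρ) T h C

end

/-! Push `T`, `h` and the sets `C v` forward along the diffeomorphism `φ`. Covering, nerve and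
condition (i) survive any homeomorphism, and (ii) survives if `φ` is Lipschitz at small scale. Only
(iii) is delicate, since `φ` does not carry convex hulls to convex hulls. But at scale `ρ` the
inverse `φ.symm` is affine up to an error `O(ρ²)`, and affine maps do respect convex hulls. The
allowed offset `η₀ * ρ` is linear in `ρ`, so for small `ρ` it absorbs the quadratic error and the
distortion of a smaller offset.

The affine approximation must act on the ambient space, because points of a convex hull leave the
manifold; hence the linear maps `A : E →L[ℝ] F` below. `C11On.exists_factor` builds them in charts,
compactness makes the constants uniform, and `NicelyTriangulable.of_homeomorph` balances the errors.
-/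

/-- A map `Ψ` between subsets of normed spaces has uniform first order expansions: at every point
`p` it is, up to a quadratic error, the restriction of an affine map, with constants that do not
depend on `p`. -/
def UniformFirstOrderExpansion {E F : Type*} [NormedAddCommGroup E] [NormedSpace ℝ E]
    [NormedAddCommGroup F] [NormedSpace ℝ F] {X : Set E} {Y : Set F} (Ψ : X → Y) : Prop :=
  ∃ ε > (0 : ℝ), ∃ L K : ℝ, ∀ p : X, ∃ A : E →L[ℝ] F, ‖A‖ ≤ L ∧
    ∀ q : X, dist q p < ε →
      ‖(Ψ q : F) - Ψ p - A (q - p)‖ ≤ K * ‖(q : E) - p‖ ^ 2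

/-! ### Local estimates for `C^{1,1}` maps -/

section Calculus

variable {E F G : Type*} [NormedAddCommGroup E] [NormedSpace ℝ E] [NormedAddCommGroup F]
  [NormedSpace ℝ F] [NormedAddCommGroup G] [NormedSpace ℝ G]

theorem C11On.continuousAt_fderiv {f : E → F} {s : Set E} (hs : IsOpen s) (hf : C11On f s)
    {x : E} (hx : x ∈ s) : ContinuousAt (fderiv ℝ f) x := by
  obtain ⟨K, u, hu, hK⟩ := hf.2 hx
  rw [hs.nhdsWithin_eq hx] at hu
  exact hK.continuousOn.continuousAt hu

theorem C11On.hasStrictFDerivAt {f : E → F} {s : Set E} (hs : IsOpen s) (hf : C11On f s)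
    {x : E} (hx : x ∈ s) : HasStrictFDerivAt f (fderiv ℝ f x) x :=
  hasStrictFDerivAt_of_hasFDerivAt_of_continuousAt
    (Filter.eventually_of_mem (hs.mem_nhds hx) fun y hy =>
      ((hf.1 y hy).differentiableAt (hs.mem_nhds hy)).hasFDerivAt) (hf.continuousAt_fderiv hs hx)

/-- The first order Taylor expansion of a `C^{1,1}` map has a locally uniform quadratic error. -/
theorem C11On.exists_quadratic_bound {f : E → F} {s : Set E} (hs : IsOpen s) (hf : C11On f s)
    {x : E} (hx : x ∈ s) : ∃ K : ℝ, 0 ≤ K ∧ ∃ t ∈ 𝓝 x, ∀ u ∈ t, ∀ w ∈ t,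
      ‖f w - f u - fderiv ℝ f u (w - u)‖ ≤ K * ‖w - u‖ ^ 2 := by
  obtain ⟨K, t, ht, hK⟩ := hf.2 hx
  rw [hs.nhdsWithin_eq hx] at ht
  obtain ⟨r, hr, hball⟩ := Metric.mem_nhds_iff.1 (Filter.inter_mem ht (hs.mem_nhds hx))
  refine ⟨K, K.2, ball x r, ball_mem_nhds x hr, fun u hu w hw => ?_⟩
  have hseg : segment ℝ u w ⊆ ball x r := (convex_ball x r).segment_subset hu hw
  have := (convex_segment u w).norm_image_sub_le_of_norm_hasFDerivWithin_le' (f := f)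
    (f' := fderiv ℝ f) (φ := fderiv ℝ f u) (C := K * ‖w - u‖)
    (fun y hy => ((hf.1 y (hball (hseg hy)).2).differentiableAt
      (hs.mem_nhds (hball (hseg hy)).2)).hasFDerivAt.hasFDerivWithinAt)
    (fun y hy => by
      have h1 := hK.dist_le_mul y (hball (hseg hy)).1 u (hball hu).1
      rw [dist_eq_norm, dist_eq_norm] at h1
      refine h1.trans (mul_le_mul_of_nonneg_left ?_ K.2)
      obtain ⟨a, b, ha, hb, hab, rfl⟩ := hy
      have : a • u + b • w - u = b • (w - u) := by
        rw [← sub_eq_zero, show a = 1 - b by linarith]; module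
      rw [this, norm_smul, Real.norm_of_nonneg hb]
      exact mul_le_of_le_one_left (norm_nonneg _) (by linarith))
    (left_mem_segment ℝ u w) (right_mem_segment ℝ u w)
  rw [pow_two, ← mul_assoc]
  exact this

/-- If `f` is a `C^{1,1}` immersion at `x`, a `C^{1,1}` map `g` factors through `f` near `x` up to
a quadratic error, by linear maps of bounded norm. -/
theorem C11On.exists_factor [FiniteDimensional ℝ E] [FiniteDimensional ℝ F]
    {f : E → F} {g : E → G} {s : Set E} (hs : IsOpen s) (hf : C11On f s) (hg : C11On g s)
    {x : E} (hx : x ∈ s) (hinj : Function.Injective (fderiv ℝ f x)) :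
    ∃ L K : ℝ, ∃ t ∈ 𝓝 x, ∀ u ∈ t, ∃ A : F →L[ℝ] G, ‖A‖ ≤ L ∧ ∀ w ∈ t,
      ‖g w - g u - A (f w - f u)‖ ≤ K * ‖f w - f u‖ ^ 2 := by
  -- A left inverse `B₀` of the derivative at `x` is corrected at nearby `u` by the inverse of `B₀ ∘
  -- f'(u)`, which exists and stays bounded because units are open and inversion is continuous.
  obtain ⟨B₀', hB₀'⟩ := (fderiv ℝ f x : E →ₗ[ℝ] F).exists_leftInverse_of_injective
    (LinearMap.ker_eq_bot.2 hinj)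
  set B₀ : F →L[ℝ] E := LinearMap.toContinuousLinearMap B₀'
  have hid : B₀.comp (fderiv ℝ f x) = 1 := by
    ext v
    exact LinearMap.congr_fun hB₀' v
  have hunit : IsUnit (B₀.comp (fderiv ℝ f x)) := by rw [hid]; exact isUnit_one
  have hcomp : ContinuousAt (fun u => B₀.comp (fderiv ℝ f u)) x :=
    continuousAt_const.clm_comp (hf.continuousAt_fderiv hs hx)
  have h1 : ∀ᶠ u in 𝓝 x, IsUnit (B₀.comp (fderiv ℝ f u)) :=
    hcomp.eventually (Units.isOpen.mem_nhds hunit)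
  have hinv : ContinuousAt (fun u => Ring.inverse (B₀.comp (fderiv ℝ f u))) x := by
    obtain ⟨U, hU⟩ := hunit
    refine ContinuousAt.comp (g := Ring.inverse) ?_ hcomp
    rw [← hU]
    exact NormedRing.inverse_continuousAt U
  obtain ⟨b, hb⟩ := hinv.norm.eventually (gt_mem_nhds (lt_add_one _)) |>.exists_mem
  obtain ⟨c, hc⟩ := (hg.continuousAt_fderiv hs hx).norm.eventually
    (gt_mem_nhds (lt_add_one _)) |>.exists_mem
  set b₀ := ‖Ring.inverse (B₀.comp (fderiv ℝ f x))‖ + 1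
  set c₀ := ‖fderiv ℝ g x‖ + 1
  obtain ⟨K₁, hK₁, t₁, ht₁, hft⟩ := hf.exists_quadratic_bound hs hx
  obtain ⟨K₂, hK₂, t₂, ht₂, hgt⟩ := hg.exists_quadratic_bound hs hx
  have hstrict : HasStrictFDerivAt (fun u => B₀ (f u)) (1 : E →L[ℝ] E) x := by
    rw [← hid]
    exact B₀.hasStrictFDerivAt.comp x (hf.hasStrictFDerivAt hs hx)
  -- `B₀ ∘ f` is the identity up to a `1/2`-Lipschitz error, so distances in the chart are
  -- controlled by distances between values of `f`.
  obtain ⟨t₃, ht₃, happ⟩ := hstrict.approximates_deriv_on_nhds (c := 1 / 2) (Or.inr (by norm_num))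
  have hanti : ∀ u ∈ t₃, ∀ w ∈ t₃, ‖w - u‖ ≤ 2 * ‖B₀‖ * ‖f w - f u‖ := by
    intro u hu w hw
    have h2 := happ w hw u hu
    have h3 := B₀.le_opNorm (f w - f u)
    have h4 := norm_sub_norm_le (w - u) (B₀ (f w) - B₀ (f u))
    rw [norm_sub_rev (w - u) (B₀ (f w) - B₀ (f u)), ← map_sub] at h4
    simp only [← map_sub, one_apply_eq_self] at h2
    push_cast at h2
    linarith
  have hb₀ : 0 ≤ b₀ := by positivity
  have hc₀ : 0 ≤ c₀ := by positivity
  refine ⟨c₀ * (b₀ * ‖B₀‖), (K₂ + c₀ * (b₀ * ‖B₀‖) * K₁) * (2 * ‖B₀‖) ^ 2,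
    {u | IsUnit (B₀.comp (fderiv ℝ f u))} ∩ b ∩ c ∩ t₁ ∩ t₂ ∩ t₃, ?_, ?_⟩
  · exact Filter.inter_mem (Filter.inter_mem (Filter.inter_mem (Filter.inter_mem
      (Filter.inter_mem h1 hb.1) hc.1) ht₁) ht₂) ht₃
  rintro u ⟨⟨⟨⟨⟨hu, hub⟩, huc⟩, hu₁⟩, hu₂⟩, hu₃⟩
  set B : F →L[ℝ] E := (Ring.inverse (B₀.comp (fderiv ℝ f u))).comp B₀
  have hBf : ∀ v, B (fderiv ℝ f u v) = v := fun v => by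
    have := congrArg (fun T : E →L[ℝ] E => T v) (Ring.inverse_mul_cancel _ hu)
    exact this
  have hnorm : ‖(fderiv ℝ g u).comp B‖ ≤ c₀ * (b₀ * ‖B₀‖) := by
    refine (ContinuousLinearMap.opNorm_comp_le _ _).trans ?_
    refine mul_le_mul (hc.2 u huc).le ?_ (norm_nonneg _) hc₀
    refine (ContinuousLinearMap.opNorm_comp_le _ _).trans ?_
    exact mul_le_mul_of_nonneg_right (hb.2 u hub).le (norm_nonneg _)
  refine ⟨(fderiv ℝ g u).comp B, hnorm, ?_⟩
  rintro w ⟨⟨⟨-, hw₁⟩, hw₂⟩, hw₃⟩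
  -- As `B` is a left inverse of `f'(u)`, the first order terms cancel and only the two Taylor
  -- remainders are left.
  have e : g w - g u - (fderiv ℝ g u).comp B (f w - f u) =
      (g w - g u - fderiv ℝ g u (w - u)) -
        (fderiv ℝ g u).comp B (f w - f u - fderiv ℝ f u (w - u)) := by
    simp only [map_sub _ (f w - f u), ContinuousLinearMap.comp_apply, hBf]
    abel
  rw [e]
  have h5 : ‖w - u‖ ^ 2 ≤ (2 * ‖B₀‖) ^ 2 * ‖f w - f u‖ ^ 2 := by
    rw [← mul_pow]
    exact pow_le_pow_left₀ (norm_nonneg _) (hanti u hu₃ w hw₃) 2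
  calc _ ≤ K₂ * ‖w - u‖ ^ 2 + c₀ * (b₀ * ‖B₀‖) * (K₁ * ‖w - u‖ ^ 2) :=
        (norm_sub_le _ _).trans (add_le_add (hgt u hu₂ w hw₂)
          (((fderiv ℝ g u).comp B).le_of_opNorm_le_of_le hnorm (hft u hu₁ w hw₁)))
    _ = (K₂ + c₀ * (b₀ * ‖B₀‖) * K₁) * ‖w - u‖ ^ 2 := by ring
    _ ≤ (K₂ + c₀ * (b₀ * ‖B₀‖) * K₁) * ((2 * ‖B₀‖) ^ 2 * ‖f w - f u‖ ^ 2) :=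
        mul_le_mul_of_nonneg_left h5 (by positivity)
    _ = _ := by ring

end Calculus

/-! ### Uniform expansions on compact manifolds -/

/-- On a compact set, locally uniform first order expansions are uniform. -/
theorem UniformFirstOrderExpansion.of_locally {E F : Type*} [NormedAddCommGroup E]
    [NormedSpace ℝ E] [NormedAddCommGroup F] [NormedSpace ℝ F] {X : Set E} {Y : Set F}
    (hX : IsCompact X) {Ψ : X → Y}
    (h : ∀ x : X, ∃ L K : ℝ, ∃ t ∈ 𝓝 x, ∀ p ∈ t, ∃ A : E →L[ℝ] F, ‖A‖ ≤ L ∧ ∀ q ∈ t,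
      ‖(Ψ q : F) - Ψ p - A (q - p)‖ ≤ K * ‖(q : E) - p‖ ^ 2) :
    UniformFirstOrderExpansion Ψ := by
  have : CompactSpace X := isCompact_iff_compactSpace.1 hX
  have key : ∃ ε > (0 : ℝ), ∃ L K : ℝ, ∀ p ∈ (univ : Set X), ∃ A : E →L[ℝ] F, ‖A‖ ≤ L ∧
      ∀ q : X, dist q p < ε → ‖(Ψ q : F) - Ψ p - A (q - p)‖ ≤ K * ‖(q : E) - p‖ ^ 2 := by
    refine isCompact_univ.induction_on (p := fun S : Set X => ∃ ε > (0 : ℝ), ∃ L K : ℝ, ∀ p ∈ S,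
      ∃ A : E →L[ℝ] F, ‖A‖ ≤ L ∧ ∀ q : X, dist q p < ε →
        ‖(Ψ q : F) - Ψ p - A (q - p)‖ ≤ K * ‖(q : E) - p‖ ^ 2)
      ⟨1, one_pos, 0, 0, fun p hp => hp.elim⟩ ?_ ?_ ?_
    · rintro S S' hS ⟨ε, hε, L, K, H⟩
      exact ⟨ε, hε, L, K, fun p hp => H p (hS hp)⟩
    · rintro S S' ⟨ε, hε, L, K, H⟩ ⟨ε', hε', L', K', H'⟩
      refine ⟨min ε ε', lt_min hε hε', max L L', max K K', ?_⟩
      rintro p (hp | hp)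
      · obtain ⟨A, hA, hq⟩ := H p hp
        exact ⟨A, hA.trans (le_max_left _ _), fun q hqp =>
          (hq q (hqp.trans_le (min_le_left _ _))).trans
            (mul_le_mul_of_nonneg_right (le_max_left _ _) (sq_nonneg _))⟩
      · obtain ⟨A, hA, hq⟩ := H' p hp
        exact ⟨A, hA.trans (le_max_right _ _), fun q hqp =>
          (hq q (hqp.trans_le (min_le_right _ _))).trans
            (mul_le_mul_of_nonneg_right (le_max_right _ _) (sq_nonneg _))⟩
    · intro x _
      obtain ⟨L, K, t, ht, H⟩ := h x
      obtain ⟨r, hr, hball⟩ := Metric.mem_nhds_iff.1 ht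
      -- Halving the radius keeps every `q` within `r / 2` of such a `p` inside `t`.
      refine ⟨ball x (r / 2), mem_nhdsWithin_of_mem_nhds (ball_mem_nhds x (half_pos hr)),
        r / 2, half_pos hr, L, K, fun p hp => ?_⟩
      obtain ⟨A, hA, hq⟩ := H p (hball (ball_subset_ball (by linarith) hp))
      refine ⟨A, hA, fun q hqp => hq q (hball ?_)⟩
      have := dist_triangle q p x
      rw [mem_ball] at hp ⊢
      linarith
  obtain ⟨ε, hε, L, K, H⟩ := key
  exact ⟨ε, hε, L, K, fun p => H p (mem_univ p)⟩

/-- A `C^{1,1}` diffeomorphism between embedded `C^{1,1}` manifolds, the source being compact, has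
uniform first order expansions. -/
theorem Structomorph.uniformFirstOrderExpansion {k d d' : ℕ}
    {M : Set (EuclideanSpace ℝ (Fin d))} {M' : Set (EuclideanSpace ℝ (Fin d'))}
    [ChartedSpace (EuclideanSpace ℝ (Fin k)) M] [ChartedSpace (EuclideanSpace ℝ (Fin k)) M']
    (hM : IsCompact M) (hMemb : InclusionIsC11Embedding k M)
    (hMemb' : InclusionIsC11Embedding k M') (Φ : Structomorph (c11Groupoid k) M M') :
    UniformFirstOrderExpansion Φ.toHomeomorph := by
  refine UniformFirstOrderExpansion.of_locally hM fun x => ?_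
  set c := chartAt (EuclideanSpace ℝ (Fin k)) x
  set c' := chartAt (EuclideanSpace ℝ (Fin k)) (Φ.toHomeomorph x)
  set e := c.symm.trans (Φ.toHomeomorph.toOpenPartialHomeomorph.trans c') with he
  have hmem := (mem_c11Groupoid.1 (Φ.mem_groupoid c c' (chart_mem_atlas _ x)
    (chart_mem_atlas _ _))).1
  obtain ⟨hf, hinj⟩ := hMemb c (chart_mem_atlas _ x)
  obtain ⟨hf', -⟩ := hMemb' c' (chart_mem_atlas _ _)
  set f : EuclideanSpace ℝ (Fin k) → EuclideanSpace ℝ (Fin d) := fun u => (c.symm u : M) with hfdef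
  set g : EuclideanSpace ℝ (Fin k) → EuclideanSpace ℝ (Fin d') :=
    fun u => (Φ.toHomeomorph (c.symm u) : M') with hgdef
  have hxs : x ∈ c.source := mem_chart_source _ x
  have hxs' : Φ.toHomeomorph x ∈ c'.source := mem_chart_source _ _
  have hsrc : e.source ⊆ c.target := fun u hu => by
    simp only [he, OpenPartialHomeomorph.trans_source] at hu
    exact hu.1
  have hsrc' : ∀ u ∈ e.source, Φ.toHomeomorph (c.symm u) ∈ c'.source := fun u hu => by
    simp only [he, OpenPartialHomeomorph.trans_source] at hu
    exact hu.2.2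
  have hxe : c x ∈ e.source := by
    simp only [he, OpenPartialHomeomorph.trans_source]
    refine ⟨c.map_source hxs, ?_, ?_⟩
    · simp
    · simpa [c.left_inv hxs] using hxs'
  -- On `e.source`, `g` is the inclusion of `M'` read in `c'`, composed with the transition map `e`.
  have hgC : C11On g e.source := by
    have h1 := C11On.comp e.open_source c'.open_target hmem hf'
    have h2 : e.source ∩ e ⁻¹' c'.target = e.source :=
      inter_eq_left.2 fun u hu => c'.map_source (hsrc' u hu)
    rw [h2] at h1
    refine h1.congr e.open_source fun u hu => ?_
    have : c'.symm (e u) = Φ.toHomeomorph (c.symm u) := c'.left_inv (hsrc' u hu)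
    exact (congrArg Subtype.val this).symm
  have hfC : C11On f e.source := ⟨hf.1.mono hsrc, hf.2.mono hsrc⟩
  obtain ⟨L, K, t, ht, H⟩ := hfC.exists_factor e.open_source hgC hxe (hinj _ (hsrc hxe))
  refine ⟨L, K, c ⁻¹' t ∩ c.source,
    Filter.inter_mem ((c.continuousAt hxs) ht) (c.open_source.mem_nhds hxs), ?_⟩
  rintro p ⟨hpt, hps⟩
  obtain ⟨A, hA, hq⟩ := H (c p) hpt
  refine ⟨A, hA, ?_⟩
  rintro q ⟨hqt, hqs⟩
  have := hq (c q) hqt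
  simpa only [hfdef, hgdef, c.left_inv hps, c.left_inv hqs] using this

/-- For distances below `ε` the quadratic error is at most `|K| * ε` times the distance, which adds
to the bound on `‖A‖`. -/
theorem UniformFirstOrderExpansion.exists_local_lipschitz {E F : Type*} [NormedAddCommGroup E]
    [NormedSpace ℝ E] [NormedAddCommGroup F] [NormedSpace ℝ F] {X : Set E} {Y : Set F}
    {Ψ : X → Y} (h : UniformFirstOrderExpansion Ψ) :
    ∃ ε > (0 : ℝ), ∃ L ≥ (1 : ℝ), ∀ p q : X, dist q p < ε → dist (Ψ q) (Ψ p) ≤ L * dist q p := by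
  obtain ⟨ε, hε, L, K, H⟩ := h
  refine ⟨ε, hε, max 1 (L + |K| * ε), le_max_left _ _, fun p q hqp => ?_⟩
  obtain ⟨A, hA, hq⟩ := H p
  have h1 := hq q hqp
  rw [Subtype.dist_eq, dist_eq_norm, Subtype.dist_eq, dist_eq_norm] at *
  set D := ‖(q : E) - p‖
  have h2 : ‖A (q - p)‖ ≤ L * D := A.le_of_opNorm_le hA _
  have h3 := norm_sub_norm_le ((Ψ q : F) - Ψ p) (A (q - p))
  have hD : 0 ≤ D := norm_nonneg _
  have h4 : K * D ^ 2 ≤ |K| * ε * D := by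
    calc K * D ^ 2 ≤ |K| * D ^ 2 := mul_le_mul_of_nonneg_right (le_abs_self K) (sq_nonneg D)
      _ = |K| * (D * D) := by ring
      _ ≤ |K| * (ε * D) := by gcongr
      _ = _ := by ring
  calc _ ≤ (L + |K| * ε) * D := by linarith
    _ ≤ _ := mul_le_mul_of_nonneg_right (le_max_right _ _) hD

/-! ### Convex hulls and transport of triangulations -/

/-- If a map is affine up to an error `r` on a set, it maps convex combinations of points of the
set to convex combinations of the images, up to the error `r`. -/
theorem exists_mem_convexHull_image_of_approx {E F : Type*} [NormedAddCommGroup E]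
    [NormedSpace ℝ E] [NormedAddCommGroup F] [NormedSpace ℝ F] {S : Set E} {T : Set F}
    (A : E →L[ℝ] F) (b : F) {r : ℝ} (h : ∀ s ∈ S, ∃ t ∈ T, ‖A s + b - t‖ ≤ r) {s : E}
    (hs : s ∈ convexHull ℝ S) : ∃ t ∈ convexHull ℝ T, ‖A s + b - t‖ ≤ r := by
  suffices h' : convexHull ℝ S ⊆ {s | ∃ t ∈ convexHull ℝ T, ‖A s + b - t‖ ≤ r} from h' hs
  refine convexHull_min (fun s hs => ?_) ?_
  · obtain ⟨t, ht, hst⟩ := h s hs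
    exact ⟨t, subset_convexHull ℝ T ht, hst⟩
  · rintro x ⟨t, ht, hxt⟩ y ⟨u, hu, hyu⟩ α β hα hβ hαβ
    refine ⟨α • t + β • u, convex_convexHull ℝ T ht hu hα hβ hαβ, ?_⟩
    have e : A (α • x + β • y) + b - (α • t + β • u) = α • (A x + b - t) + β • (A y + b - u) := by
      have hb : b = α • b + β • b := by rw [← add_smul, hαβ, one_smul]
      rw [map_add, map_smul, map_smul]
      nth_rewrite 1 [hb]
      module
    rw [e]
    calc _ ≤ α * ‖A x + b - t‖ + β * ‖A y + b - u‖ := by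
          refine (norm_add_le _ _).trans (le_of_eq ?_)
          rw [norm_smul, norm_smul, Real.norm_of_nonneg hα, Real.norm_of_nonneg hβ]
      _ ≤ α * r + β * r := by gcongr
      _ = r := by rw [← add_mul, hαβ, one_mul]

/-- Transport of a nice triangulation along a homeomorphism. -/
theorem IsNiceTriangulation.image {V : Type*} [Fintype V] {d d' : ℕ}
    {M : Set (EuclideanSpace ℝ (Fin d))} {M' : Set (EuclideanSpace ℝ (Fin d'))} (φ : M ≃ₜ M')
    {ρ δ ρ' δ' : ℝ} {T : AbstractSimplicialComplex V} {h : underlyingSpace T ≃ₜ M}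
    {C : V → Set (EuclideanSpace ℝ (Fin d))} (hT : IsNiceTriangulation M ρ δ T h C)
    (hball : ∀ p q : M, dist q p < ρ → dist (φ q) (φ p) < ρ')
    (hoffset : ∀ (S : Set M) (p : M), S ⊆ ball p ρ → ∀ y : M',
      (y : EuclideanSpace ℝ (Fin d')) ∈
        offset (convexHull ℝ ((fun x : M => (φ x : EuclideanSpace ℝ (Fin d'))) '' S)) δ' →
      (φ.symm y : EuclideanSpace ℝ (Fin d)) ∈ offset (convexHull ℝ (Subtype.val '' S)) δ) :
    IsNiceTriangulation M' ρ' δ' T (h.trans φ)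
      (fun v => (fun x : M => (φ x : EuclideanSpace ℝ (Fin d'))) '' (Subtype.val ⁻¹' C v)) := by
  have hCM : ∀ v, C v ⊆ M := fun v => hT.covering ▸ subset_iUnion C v
  refine ⟨fun v => ?_, ?_, ?_, ?_, ?_, ?_⟩
  · refine IsCompact.image ?_ (continuous_subtype_val.comp φ.continuous)
    exact Topology.IsInducing.subtypeVal.isCompact_preimage_iff
      (by simpa using hCM v) |>.2 (hT.isCompact v)
  · ext y
    simp only [mem_iUnion, mem_image, mem_preimage]
    constructor
    · rintro ⟨v, x, -, rfl⟩
      exact (φ x).2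
    · intro hy
      have hx : (φ.symm ⟨y, hy⟩ : EuclideanSpace ℝ (Fin d)) ∈ ⋃ v, C v := by
        rw [hT.covering]; exact (φ.symm ⟨y, hy⟩).2
      obtain ⟨v, hv⟩ := mem_iUnion.1 hx
      exact ⟨v, φ.symm ⟨y, hy⟩, hv, by simp⟩
  · rw [← hT.nerve_eq]
    ext σ
    refine and_congr_right fun hσ => ?_
    constructor
    · rintro ⟨y, hy⟩
      simp only [mem_iInter] at hy
      obtain ⟨v₀, hv₀⟩ := hσ
      obtain ⟨x, -, rfl⟩ := hy v₀ hv₀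
      refine ⟨x, ?_⟩
      simp only [mem_iInter]
      intro v hv
      obtain ⟨x', hx', hxx'⟩ := hy v hv
      rwa [φ.injective (Subtype.val_injective hxx')] at hx'
    · rintro ⟨x, hx⟩
      simp only [mem_iInter] at hx
      obtain ⟨v₀, hv₀⟩ := hσ
      have hxM : x ∈ M := hCM v₀ (hx v₀ hv₀)
      refine ⟨φ ⟨x, hxM⟩, ?_⟩
      simp only [mem_iInter]
      exact fun v hv => ⟨⟨x, hxM⟩, hx v hv, rfl⟩
  · intro σ hσ x hx
    obtain ⟨v, hv⟩ := mem_iUnion.1 (hT.simplex_subset σ hσ x hx)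
    obtain ⟨hvσ, hv⟩ := mem_iUnion.1 hv
    exact mem_biUnion hvσ ⟨h x, hv, rfl⟩
  · rintro v _ ⟨x, hx, rfl⟩
    exact hball (h (vertexPoint T v)) x (hT.subset_ball v hx)
  · rintro v y ⟨hyM, hy⟩
    -- Condition (ii) for `C v` supplies the smallness that the offset hypothesis needs.
    have h1 := hoffset (Subtype.val ⁻¹' C v) (h (vertexPoint T v))
      (fun x hx => hT.subset_ball v hx) ⟨y, hyM⟩ hy
    rw [Subtype.image_preimage_coe, inter_eq_right.2 (hCM v)] at h1
    obtain ⟨x, hx, hxy⟩ := hT.offset_subset v ⟨(φ.symm ⟨y, hyM⟩).2, h1⟩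
    refine ⟨x, hx, ?_⟩
    have : h x = φ.symm ⟨y, hyM⟩ := Subtype.val_injective hxy
    simp [this]

/-- A homeomorphism which, together with its inverse, has uniform first order expansions
preserves nice triangulability. -/
theorem NicelyTriangulable.of_homeomorph {d d' : ℕ} {M : Set (EuclideanSpace ℝ (Fin d))}
    {M' : Set (EuclideanSpace ℝ (Fin d'))} (hM : NicelyTriangulable M) (φ : M ≃ₜ M')
    (hφ : UniformFirstOrderExpansion φ) (hφ' : UniformFirstOrderExpansion φ.symm) :
    NicelyTriangulable M' := by
  obtain ⟨ρ₀, hρ₀, η₀, hη₀, H⟩ := hM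
  obtain ⟨ε₁, hε₁, L₁, hL₁, hlip⟩ := hφ.exists_local_lipschitz
  obtain ⟨ε₂, hε₂, L₂', K', hexp⟩ := hφ'
  obtain ⟨L₂, hL₂, hLL⟩ : ∃ L ≥ (1 : ℝ), L₂' ≤ L := ⟨max 1 L₂', le_max_left _ _, le_max_right _ _⟩
  obtain ⟨K, hK, hKK⟩ : ∃ K ≥ (1 : ℝ), K' ≤ K := ⟨max 1 K', le_max_left _ _, le_max_right _ _⟩
  have hL₁0 : 0 < L₁ := by linarith
  have hL₂0 : 0 < L₂ := by linarith
  have hK0 : 0 < K := by linarith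
  -- `ε₂ / 2` makes the expansion of `φ.symm` valid at distance `2 * ρ'`; `η₀ / (10 * K * L₁)`
  -- bounds the total quadratic error `5 * K * ρ' ^ 2` by `η₀ * ρ / 2`, where `ρ = ρ' / L₁`.
  refine ⟨min (min ρ₀ ε₁) (min (ε₂ / 2) (η₀ / (10 * K * L₁))), by positivity,
    -- The `1` keeps the offset points within `2 * ρ'` of `φ p`; the other term gives the stretched
    -- offset the remaining half of `η₀ * ρ`.
    min 1 (η₀ / (2 * L₂ * L₁)), by positivity, fun ρ' hρ' hlt => ?_⟩
  simp only [lt_min_iff] at hlt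
  obtain ⟨⟨hlt₀, hlt₁⟩, hlt₂, hlt₃⟩ := hlt
  set η := min 1 (η₀ / (2 * L₂ * L₁)) with hη
  have hη1 : η ≤ 1 := min_le_left _ _
  have hη2 : L₂ * η * L₁ ≤ η₀ / 2 := by
    have h1 : η ≤ η₀ / (2 * L₂ * L₁) := min_le_right _ _
    rw [le_div_iff₀ (by positivity)] at h1
    linarith
  rw [lt_div_iff₀ (by positivity)] at hlt₃
  set ρ := ρ' / L₁ with hρ
  have hρρ : L₁ * ρ = ρ' := by rw [hρ]; field_simp
  have hρ0 : 0 < ρ := by positivity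
  have hρle : ρ ≤ ρ' := by nlinarith
  obtain ⟨V, hV, T, h, C, hT⟩ := H ρ hρ0 (hρle.trans_lt hlt₀)
  have hball : ∀ p q : M, dist q p < ρ → dist (φ q) (φ p) < ρ' := fun p q hqp => by
    refine (hlip p q (by linarith)).trans_lt ?_
    rw [← hρρ]
    exact mul_lt_mul_of_pos_left hqp hL₁0
  refine ⟨V, hV, T, h.trans φ, _, hT.image φ hball fun S p hS y hy => ?_⟩
  obtain ⟨s, hs, hys⟩ := mem_iUnion₂.1 hy
  obtain ⟨A, hA, hq⟩ := hexp (φ p)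
  have hquad : ∀ q : M', dist q (φ p) ≤ 2 * ρ' → ‖A q + (p - A (φ p)) - φ.symm q‖ ≤
      K * ‖(q : EuclideanSpace ℝ (Fin d')) - φ p‖ ^ 2 := fun q hqp => by
    have h1 := (hq q (by linarith)).trans (mul_le_mul_of_nonneg_right hKK (sq_nonneg _))
    rw [φ.symm_apply_apply, norm_sub_rev, map_sub] at h1
    have e : A q + (p - A (φ p)) - φ.symm q = A q - A (φ p) - (φ.symm q - p) := by abel
    rw [e]
    exact h1
  obtain ⟨t, ht, hst⟩ := exists_mem_convexHull_image_of_approx (T := Subtype.val '' S) A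
    (p - A (φ p)) (r := K * ρ' ^ 2) (by
      rintro _ ⟨x, hx, rfl⟩
      have h1 := hball p x (hS hx)
      refine ⟨x, mem_image_of_mem _ hx, ?_⟩
      have h2 := hquad (φ x) (by linarith)
      rw [φ.symm_apply_apply, ← dist_eq_norm (φ x : EuclideanSpace ℝ (Fin d')),
        ← Subtype.dist_eq] at h2
      exact h2.trans (by gcongr)) hs
  have hsp : dist s (φ p) ≤ ρ' := by
    have h1 : convexHull ℝ ((fun x : M => (φ x : EuclideanSpace ℝ (Fin d'))) '' S) ⊆
        closedBall (φ p : EuclideanSpace ℝ (Fin d')) ρ' :=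
      convexHull_min (by rintro _ ⟨x, hx, rfl⟩; exact (hball p x (hS hx)).le)
        (convex_closedBall _ _)
    exact h1 hs
  rw [mem_closedBall] at hys
  have hyp : dist (y : EuclideanSpace ℝ (Fin d')) (φ p) ≤ η * ρ' + ρ' :=
    (dist_triangle _ s _).trans (add_le_add hys hsp)
  have hηρ : η * ρ' ≤ ρ' := mul_le_of_le_one_left hρ'.le hη1
  refine mem_biUnion ht ?_
  rw [mem_closedBall, dist_eq_norm]
  have hy2 : ‖A y + (p - A (φ p)) - φ.symm y‖ ≤ K * (2 * ρ') ^ 2 := by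
    refine (hquad y (by rw [Subtype.dist_eq]; linarith)).trans ?_
    rw [← dist_eq_norm (y : EuclideanSpace ℝ (Fin d'))]
    gcongr
    linarith
  have hAy : ‖A ((y : EuclideanSpace ℝ (Fin d')) - s)‖ ≤ L₂ * (η * ρ') := by
    refine A.le_of_opNorm_le_of_le (hA.trans hLL) ?_
    rwa [← dist_eq_norm]
  -- Three errors: the offset stretched by `A`, the approximation on the hull, and the approximation
  -- at `y`.
  have e : (φ.symm y : EuclideanSpace ℝ (Fin d)) - t =
      A (y - s) + (A s + (p - A (φ p)) - t) - (A y + (p - A (φ p)) - φ.symm y) := by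
    rw [map_sub]; abel
  rw [e]
  have h6 : L₂ * (η * ρ') + K * ρ' ^ 2 + K * (2 * ρ') ^ 2 ≤ η₀ * ρ := by
    have h7 : L₂ * (η * ρ') ≤ η₀ / 2 * ρ := by
      calc L₂ * (η * ρ') = L₂ * η * L₁ * ρ := by rw [← hρρ]; ring
        _ ≤ _ := mul_le_mul_of_nonneg_right hη2 hρ0.le
    have h8 : K * ρ' ^ 2 + K * (2 * ρ') ^ 2 ≤ η₀ / 2 * ρ := by
      calc K * ρ' ^ 2 + K * (2 * ρ') ^ 2 = (ρ' * (10 * K * L₁)) / 2 * ρ := by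
            linear_combination -5 * K * ρ' * hρρ
        _ ≤ _ := by gcongr
    linarith
  exact ((norm_sub_le _ _).trans (add_le_add ((norm_add_le _ _).trans
    (add_le_add hAy hst)) hy2)).trans h6

theorem mainTheorem8 {k d d' : ℕ}
    (M : Set (EuclideanSpace ℝ (Fin d))) (M' : Set (EuclideanSpace ℝ (Fin d')))
    [ChartedSpace (EuclideanSpace ℝ (Fin k)) M] [HasGroupoid M (c11Groupoid k)]
    [ChartedSpace (EuclideanSpace ℝ (Fin k)) M'] [HasGroupoid M' (c11Groupoid k)]
    (hM : IsCompact M) (hM' : IsCompact M')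
    (hMemb : InclusionIsC11Embedding k M) (hMemb' : InclusionIsC11Embedding k M')
    (Φ : Structomorph (c11Groupoid k) M M') :
    NicelyTriangulable M ↔ NicelyTriangulable M' := by
  have h := Φ.uniformFirstOrderExpansion hM hMemb hMemb'
  have h' : UniformFirstOrderExpansion Φ.toHomeomorph.symm :=
    Φ.symm.uniformFirstOrderExpansion hM' hMemb' hMemb
  exact ⟨fun H => H.of_homeomorph Φ.toHomeomorph h h',
    fun H => H.of_homeomorph Φ.toHomeomorph.symm h' h⟩
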